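/- Let $M$ be a compact metric space and let $\nu$ be a Borel probability on $M$ with $\operatorname{supp}(\nu)=M$. Let $\Omega^{+}=\Omega^{-}=M^{\mathbb N}$, with points written $x=|x_1,x_2,\dots)\in\Omega^+$ and $y=(\dots,y_2,y_1|\in\Omega^-$, with the metric $d(x,x')=\sum_{i\ge1}2^{-i}d(x_i,x_i')$, let $\sigma|x_1,x_2,\dots)=|x_2,x_3,\dots)$, and let $\hat\Omega=\Omega^-\times\Omega^+$ with the two-sided shift $$\hat\sigma(\dots,y_2,y_1|x_1,x_2,x_3,\dots)=(\dots,y_2,y_1,x_1|x_2,x_3,\dots).$$ For a continuous potential $B:M^{\mathbb N}\to\mathbb R$ put $\mathcal L_{B,\nu}f(x)=\int e^{B(|a,x_1,x_2,\dots))}f(|a,x_1,x_2,\dots))\,d\nu(a)$, and call a Borel probability $\rho$ an eigenmeasure of $\mathcal L_{B,\nu}^*$ if for some $\lambda\in\mathbb R$ one has $\int\mathcal L_{B,\nu}f\,d\rho=\lambda\int f\,d\rho$ for all continuous $f$. (Potentials on $\Omega^-$ are treated in the same way, via $(\dots,z_2,z_1|\mapsto|z_1,z_2,\dots)$.) Let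 $A:\Omega^+\to\mathbb R$ be Lipschitz. A $\nu$-equilibrium probability of $A$ is a $\sigma$-invariant Borel probability $\mu$ on $\Omega^+$ such that $\mathcal L_{\bar A,\nu}^*\mu=\mu$, where $\bar A=A+\log h-\log(h\circ\sigma)-\log\lambda$ for some $\lambda>0$ and some continuous $h>0$ with $\mathcal L_{A,\nu}h=\lambda h$. Let $W:\hat\Omega\to\mathbb R$ be a Lipschitz involution kernel for $A$: the function $$A^-:=A\circ\hat\sigma^{-1}+W\circ\hat\sigma^{-1}-W$$ on $\hat\Omega$ (with $A$ acting on the $\Omega^+$-component) depends only on $y\in\Omega^-$. Let $\rho_A$ and $\rho_{A^-}$ be eigenmeasures of $\mathcal L_{A,\nu}^*$ and $\mathcal L_{A^-,\nu}^*$, let $c\in\mathbb R$ be such that $\iint e^{W(y|x)-c}\,d\rho_{A^-}(y)\,d\rho_A(x)=1$, and let $K(y|x)=e^{W(y|x)-c}$. Then $A$ has exactly one $\nu$-equilibrium probability $\mu_A$, and $$d\hat\mu_A=K(y|x)\,d\rho_{A^-}(y)\,d\rho_A(x)$$ is the unique $\hat\sigma$-invariant extension of $\mu_A$ to $\hat\Omega$: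 it is a $\hat\sigma$-invariant probability on $\hat\Omega$ whose projection to $\Omega^+$ is $\mu_A$, and every $\hat\sigma$-invariant Borel probability on $\hat\Omega$ whose projection to $\Omega^+$ is $\mu_A$ equals $\hat\mu_A$. -/

import Mathlib

open MeasureTheory

namespace Symbolic

/-- The one-sided sequence space `M^ℕ`. It serves both as `Ω⁺`, where `x n` is the coordinate
`x_{n+1}` of `|x₁, x₂, x₃, …)`, and as `Ω⁻`, where `y n` is the coordinate `y_{n+1}` of
`(…, y₃, y₂, y₁|`. It carries the product topology and the product (= Borel) σ-algebra. -/
abbrev OneSided (M : Type*) : Type _ := ℕ → M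

/-- The two-sided space `Ω̂ = Ω⁻ × Ω⁺`; the pair `(y, x)` is the point `(y|x)`. -/
abbrev TwoSided (M : Type*) : Type _ := OneSided M × OneSided M

/-- The sequence `|a, x₁, x₂, …)`; read in `Ω⁻`, the sequence `(…, y₂, y₁, a|`. -/
def cons {M : Type*} (a : M) (x : OneSided M) : OneSided M
  | 0 => a
  | n + 1 => x n

/-- The one-sided shift `|x₁, x₂, x₃, …) ↦ |x₂, x₃, …)`. -/
def shift {M : Type*} (x : OneSided M) : OneSided M := fun n => x (n + 1)

theorem cons_shift {M : Type*} (x : OneSided M) : cons (x 0) (shift x) = x := by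
  funext n
  cases n <;> rfl

/-- The two-sided shift
`(…, y₂, y₁|x₁, x₂, x₃, …) ↦ (…, y₂, y₁, x₁|x₂, x₃, …)`, with its inverse
`(…, y₂, y₁|x₁, x₂, …) ↦ (…, y₃, y₂|y₁, x₁, x₂, …)`. -/
def twoSidedShift (M : Type*) : TwoSided M ≃ TwoSided M where
  toFun p := (cons (p.2 0) p.1, shift p.2)
  invFun p := (shift p.1, cons (p.1 0) p.2)
  left_inv p := Prod.ext rfl (cons_shift p.2)
  right_inv p := Prod.ext (cons_shift p.1) rfl

section Metric

variable {M : Type*} [MetricSpace M]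

/-- The metric `d(x, y) = ∑_{i ≥ 1} d(x_i, y_i) / 2^i` on `M^ℕ` (the series converges because
`M` is bounded in all uses below). -/
noncomputable def seqDist (x y : OneSided M) : ℝ :=
  ∑' i : ℕ, dist (x i) (y i) / 2 ^ (i + 1)

/-- Lipschitz functions on the one-sided space. -/
def IsLipschitz (f : OneSided M → ℝ) : Prop :=
  ∃ C : ℝ, ∀ x x' : OneSided M, |f x - f x'| ≤ C * seqDist x x'

/-- Lipschitz functions on the two-sided space (for the sum metric on the product, which is
equivalent to the maximum metric). -/
def IsLipschitzTwoSided (f : TwoSided M → ℝ) : Prop :=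
  ∃ C : ℝ, ∀ p q : TwoSided M, |f p - f q| ≤ C * (seqDist p.1 q.1 + seqDist p.2 q.2)

/-- `W` is a Lipschitz involution kernel for `A`, with dual potential `A'` (usually written `A⁻`):
the function `A ∘ σ̂⁻¹ + W ∘ σ̂⁻¹ - W` on `Ω̂`, where `A` acts on the `Ω⁺` component, depends only
on the `Ω⁻` component, and equals `A'` there. -/
def IsInvolutionKernel (A : OneSided M → ℝ) (W : TwoSided M → ℝ) (A' : OneSided M → ℝ) : Prop :=
  IsLipschitzTwoSided W ∧
    ∀ p : TwoSided M,
      A' p.1 = A ((twoSidedShift M).symm p).2 + W ((twoSidedShift M).symm p) - W p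

end Metric

section Ruelle

variable {M : Type*} [MetricSpace M] [MeasurableSpace M]

/-- The Ruelle operator
`(L_{A,ν} f)(x) = ∫ e^{A(|a, x₁, x₂, …))} f(|a, x₁, x₂, …)) dν(a)`. -/
noncomputable def ruelle (ν : Measure M) (A f : OneSided M → ℝ) (x : OneSided M) : ℝ :=
  ∫ a, Real.exp (A (cons a x)) * f (cons a x) ∂ν

/-- `L_{A,ν}^* ρ = lam • ρ`, tested on continuous functions. -/
def IsDualEigenvector (ν : Measure M) (A : OneSided M → ℝ) (lam : ℝ)
    (ρ : Measure (OneSided M)) : Prop :=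
  ∀ f : C(OneSided M, ℝ), ∫ x, ruelle ν A f x ∂ρ = lam * ∫ x, f x ∂ρ

/-- `ρ` is an eigenmeasure (eigenprobability) of `L_{A,ν}^*`. -/
def IsEigenmeasure (ν : Measure M) (A : OneSided M → ℝ) (ρ : Measure (OneSided M)) : Prop :=
  IsProbabilityMeasure ρ ∧ ∃ lam : ℝ, IsDualEigenvector ν A lam ρ

/-- `h` is a positive continuous eigenfunction of `L_{A,ν}` with positive eigenvalue `lam`. -/
def IsMainEigenpair (ν : Measure M) (A : OneSided M → ℝ) (lam : ℝ)
    (h : C(OneSided M, ℝ)) : Prop :=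
  0 < lam ∧ (∀ x, 0 < h x) ∧ ∀ x, ruelle ν A h x = lam * h x

/-- The normalized potential `A + log h - log (h ∘ σ) - log lam`. -/
noncomputable def normalizedPotential (A : OneSided M → ℝ) (lam : ℝ)
    (h : C(OneSided M, ℝ)) (x : OneSided M) : ℝ :=
  A x + Real.log (h x) - Real.log (h (shift x)) - Real.log lam

/-- `μ` is the `ν`-equilibrium probability of the potential `A`: it is a shift-invariant
probability which is fixed by the dual of the Ruelle operator of the normalized potential of
`A`. -/
def IsEquilibriumProbability (ν : Measure M) (A : OneSided M → ℝ)
    (μ : Measure (OneSided M)) : Prop :=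
  IsProbabilityMeasure μ ∧ MeasurePreserving shift μ μ ∧
    ∃ (lam : ℝ) (h : C(OneSided M, ℝ)), IsMainEigenpair ν A lam h ∧
      IsDualEigenvector ν (normalizedPotential A lam h) 1 μ

/-- The measure `e^{W(y|x) - c} dρ'(y) dρ(x)` on `Ω̂`. -/
noncomputable def kernelMeasure (W : TwoSided M → ℝ) (c : ℝ) (ρ' ρ : Measure (OneSided M)) :
    Measure (TwoSided M) :=
  (ρ'.prod ρ).withDensity fun p => ENNReal.ofReal (Real.exp (W p - c))

/-- `η` is a `σ̂`-invariant probability on `Ω̂` that extends `μ`, i.e. its projection to `Ω⁺`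
is `μ`. -/
def IsInvariantExtension (μ : Measure (OneSided M)) (η : Measure (TwoSided M)) : Prop :=
  IsProbabilityMeasure η ∧ MeasurePreserving (twoSidedShift M) η η ∧ η.map Prod.snd = μ

end Ruelle

end Symbolic

open Symbolic

/-! Exponentiating the cocycle relation for `W` gives the symmetric identity
`IsInvolutionKernel.exp_mul_exp`: carrying a letter `a` across the origin trades the weight `exp A`
for `exp A'`. Integrating it against `ρ'` and using Fubini gives `ruelle_integral_kernel`. With `F =
1` this says that `h x = ∫ exp (W (y, x) - c) dρ' y` is a positive eigenfunction of the Ruelle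
operator of `A`. Pairing `h` with `ρ` forces both eigenvalues to agree, so `h dρ` is an equilibrium
probability. With general `F`, pairing with `ρ` yields the shift invariance of the kernel measure,
whose projection is `h dρ`.

Uniqueness of the equilibrium has two ingredients. Positive eigenfunctions are proportional
(`IsMainEigenpair.eq_mul`, where full support of `ν` enters), so all choices of `h` give one
normalized potential. That potential is Lipschitz, and a Lipschitz potential has at most one dual
eigenprobability per eigenvalue (`dual_eigenvector_unique`): the operator maps log-Lipschitz
functions of any constant into a fixed cone of bounded oscillation, and comparing two eigenmeasures
there contracts their discrepancy.

An invariant extension is unique because invariance fixes the law of every left-translated right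
half, and these generate the σ-algebra. -/

namespace Symbolic

/-! ### The metric on sequences. -/

section SeqDist

variable {M : Type*} [MetricSpace M]

theorem seqDist_nonneg (x y : OneSided M) : 0 ≤ seqDist x y :=
  tsum_nonneg fun _ => by positivity

theorem seqDist_self (x : OneSided M) : seqDist x x = 0 := by
  simp [seqDist]

theorem seqDist_comm (x y : OneSided M) : seqDist x y = seqDist y x := by
  simp [seqDist, dist_comm]

theorem shift_cons {M : Type*} (a : M) (x : OneSided M) : shift (cons a x) = x := rfl

theorem continuous_shift : Continuous (shift : OneSided M → OneSided M) :=
  continuous_pi fun n => continuous_apply (n + 1)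

theorem continuous_cons : Continuous fun p : M × OneSided M => cons p.1 p.2 := by
  refine continuous_pi fun n => ?_
  cases n with
  | zero => exact continuous_fst
  | succ n => exact (continuous_apply n).comp continuous_snd

theorem continuous_cons_left (x : OneSided M) : Continuous fun a : M => cons a x :=
  continuous_cons.comp (by fun_prop : Continuous fun a : M => (a, x))

theorem summable_diam_geometric :
    Summable fun i : ℕ => Metric.diam (Set.univ : Set M) * (1 / 2 : ℝ) ^ (i + 1) :=
  ((summable_nat_add_iff 1).2 summable_geometric_two).mul_left _

theorem isLipschitz_of_le {f : OneSided M → ℝ} (C : ℝ)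
    (h : ∀ x x', f x' - f x ≤ C * seqDist x x') : IsLipschitz f :=
  ⟨C, fun x x' => abs_sub_le_iff.2 ⟨seqDist_comm x x' ▸ h x' x, h x x'⟩⟩

theorem IsLipschitz.exists_nonneg {f : OneSided M → ℝ} (hf : IsLipschitz f) :
    ∃ C : ℝ, 0 ≤ C ∧ ∀ x x', f x' - f x ≤ C * seqDist x x' := by
  obtain ⟨C, hC⟩ := hf
  refine ⟨|C|, abs_nonneg C, fun x x' => ?_⟩
  have h1 := (abs_le.1 (hC x x')).1
  have h2 := mul_le_mul_of_nonneg_right (le_abs_self C) (seqDist_nonneg x x')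
  linarith

variable [CompactSpace M]

theorem seqDist_term_le (x y : OneSided M) (i : ℕ) :
    dist (x i) (y i) / 2 ^ (i + 1) ≤ Metric.diam (Set.univ : Set M) * (1 / 2) ^ (i + 1) := by
  rw [div_eq_mul_inv, one_div, inv_pow]
  gcongr
  exact Metric.dist_le_diam_of_mem isCompact_univ.isBounded trivial trivial

theorem summable_seqDist (x y : OneSided M) :
    Summable fun i : ℕ => dist (x i) (y i) / 2 ^ (i + 1) :=
  Summable.of_nonneg_of_le (fun _ => by positivity) (seqDist_term_le x y) summable_diam_geometric

theorem seqDist_eq_add (x y : OneSided M) :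
    seqDist x y = dist (x 0) (y 0) / 2 + seqDist (shift x) (shift y) / 2 := by
  rw [seqDist, (summable_seqDist x y).tsum_eq_zero_add, seqDist, ← tsum_div_const]
  simp only [zero_add, pow_one, shift]
  congr 2
  funext i
  rw [pow_succ _ (i + 1), div_div]

theorem seqDist_cons (a : M) (x y : OneSided M) :
    seqDist (cons a x) (cons a y) = seqDist x y / 2 := by
  rw [seqDist_eq_add]
  simp [cons, shift_cons]

theorem seqDist_shift_le (x y : OneSided M) : seqDist (shift x) (shift y) ≤ 2 * seqDist x y := by
  have := dist_nonneg (x := x 0) (y := y 0)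
  rw [seqDist_eq_add x y]
  linarith

theorem continuous_seqDist : Continuous fun p : OneSided M × OneSided M => seqDist p.1 p.2 := by
  refine continuous_tsum (fun i => by fun_prop) (summable_diam_geometric (M := M)) fun i p => ?_
  rw [Real.norm_of_nonneg (by positivity)]
  exact seqDist_term_le _ _ _

theorem seqDist_le_diam (x y : OneSided M) :
    seqDist x y ≤ Metric.diam (Set.univ : Set M) := by
  refine ((summable_seqDist x y).tsum_le_tsum (seqDist_term_le x y)
    summable_diam_geometric).trans_eq ?_
  rw [tsum_mul_left]
  simp only [pow_succ, tsum_mul_right, tsum_geometric_two]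
  norm_num

theorem IsLipschitz.continuous {f : OneSided M → ℝ} (hf : IsLipschitz f) : Continuous f := by
  obtain ⟨C, hC⟩ := hf
  refine continuous_iff_continuousAt.2 fun x => ?_
  rw [ContinuousAt, tendsto_iff_dist_tendsto_zero]
  have h : Continuous fun y => C * seqDist y x :=
    continuous_const.mul
      (continuous_seqDist.comp (continuous_id.prodMk continuous_const))
  have h0 := h.tendsto x
  simp only [seqDist_self, mul_zero] at h0
  exact squeeze_zero (fun _ => dist_nonneg) (fun y => by rw [Real.dist_eq]; exact hC y x) h0

theorem IsLipschitzTwoSided.continuous {f : TwoSided M → ℝ} (hf : IsLipschitzTwoSided f) :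
    Continuous f := by
  obtain ⟨C, hC⟩ := hf
  refine continuous_iff_continuousAt.2 fun x => ?_
  rw [ContinuousAt, tendsto_iff_dist_tendsto_zero]
  have h : Continuous fun y : TwoSided M => C * (seqDist y.1 x.1 + seqDist y.2 x.2) :=
    continuous_const.mul ((continuous_seqDist.comp
      (by fun_prop : Continuous fun y : TwoSided M => (y.1, x.1))).add
      (continuous_seqDist.comp (by fun_prop : Continuous fun y : TwoSided M => (y.2, x.2))))
  have h0 := h.tendsto x
  simp only [seqDist_self, add_zero, mul_zero] at h0
  exact squeeze_zero (fun _ => dist_nonneg) (fun y => by rw [Real.dist_eq]; exact hC y x) h0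

theorem dist_le_seqDist (x y : OneSided M) (i : ℕ) :
    dist (x i) (y i) ≤ 2 ^ (i + 1) * seqDist x y := by
  rw [← div_le_iff₀' (by positivity)]
  exact (summable_seqDist x y).le_tsum i fun _ _ => by positivity

theorem seqDist_triangle (x y z : OneSided M) : seqDist x z ≤ seqDist x y + seqDist y z := by
  rw [seqDist, seqDist, seqDist, ← (summable_seqDist x y).tsum_add (summable_seqDist y z)]
  refine (summable_seqDist x z).tsum_le_tsum (fun i => ?_)
    ((summable_seqDist x y).add (summable_seqDist y z))
  rw [← add_div]
  gcongr
  exact dist_triangle _ _ _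

variable (M) in
/-- The metric `seqDist`, with the product topology as its topology. -/
@[reducible] noncomputable def seqMetricSpace : MetricSpace (OneSided M) :=
  let m : MetricSpace (OneSided M) :=
    { dist := seqDist
      dist_self := seqDist_self
      dist_comm := seqDist_comm
      dist_triangle := seqDist_triangle
      eq_of_dist_eq_zero := fun {x y} h => by
        funext i
        have h' : seqDist x y = 0 := h
        have := dist_le_seqDist x y i
        rw [h', mul_zero] at this
        exact dist_le_zero.1 this }
  m.replaceTopology <| by
    apply le_antisymm
    · rw [← continuous_id_iff_le]
      refine (@continuous_iff_continuousAt _ _ _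
        m.toPseudoMetricSpace.toUniformSpace.toTopologicalSpace _).2 fun x => ?_
      refine (@tendsto_iff_dist_tendsto_zero _ _ m.toPseudoMetricSpace _ _ _).2 ?_
      have h : Continuous fun y : OneSided M => seqDist y x :=
        continuous_seqDist.comp (continuous_id.prodMk continuous_const)
      have h0 := h.tendsto x
      rwa [seqDist_self] at h0
    · rw [← continuous_id_iff_le]
      refine @continuous_pi _ _ _ m.toUniformSpace.toTopologicalSpace _ _ fun i => ?_
      refine (@LipschitzWith.of_dist_le_mul _ _ m.toPseudoMetricSpace _ (2 ^ (i + 1)) _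
        fun x y => ?_).continuous
      simpa using! dist_le_seqDist x y i

end SeqDist

/-! ### Integration of continuous functions; measures determined by test functions. -/

section Integration

theorem integrable_of_continuous {X : Type*} [TopologicalSpace X] [CompactSpace X]
    [MeasurableSpace X] [OpensMeasurableSpace X] (μ : Measure X) [IsFiniteMeasure μ]
    {f : X → ℝ} (hf : Continuous f) : Integrable f μ :=
  (BoundedContinuousFunction.mkOfCompact ⟨f, hf⟩).integrable μ

theorem continuous_integral {X Y : Type*} [TopologicalSpace X] [FirstCountableTopology X]
    [LocallyCompactSpace X] [TopologicalSpace Y] [CompactSpace Y] [MeasurableSpace Y]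
    [OpensMeasurableSpace Y] (μ : Measure Y) [IsFiniteMeasure μ]
    {f : X → Y → ℝ} (hf : Continuous (Function.uncurry f)) :
    Continuous fun x => ∫ y, f x y ∂μ := by
  simpa using continuous_parametric_integral_of_continuous (μ := μ) hf isCompact_univ

theorem integral_swap_of_continuous {X Y : Type*} [TopologicalSpace X] [CompactSpace X]
    [MeasurableSpace X] [TopologicalSpace Y] [CompactSpace Y] [MeasurableSpace Y]
    [OpensMeasurableSpace (X × Y)] (μ : Measure X) [IsFiniteMeasure μ]
    (μ' : Measure Y) [IsFiniteMeasure μ']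
    {f : X → Y → ℝ} (hf : Continuous (Function.uncurry f)) :
    ∫ x, ∫ y, f x y ∂μ' ∂μ = ∫ y, ∫ x, f x y ∂μ ∂μ' :=
  integral_integral_swap (integrable_of_continuous _ hf)

theorem ext_of_forall_integral_continuous {X : Type*} [TopologicalSpace X] [CompactSpace X]
    [HasOuterApproxClosed X] [MeasurableSpace X] [BorelSpace X] {μ μ' : Measure X}
    [IsFiniteMeasure μ] [IsFiniteMeasure μ']
    (h : ∀ f : X → ℝ, Continuous f → ∫ x, f x ∂μ = ∫ x, f x ∂μ') : μ = μ' :=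
  ext_of_forall_integral_eq_of_IsFiniteMeasure fun f => h f f.continuous

theorem integral_withDensity_ofReal {X : Type*} [TopologicalSpace X]
    [MeasurableSpace X] [OpensMeasurableSpace X] (μ : Measure X) {h : X → ℝ} (hh : Continuous h)
    (h0 : ∀ x, 0 ≤ h x) (f : X → ℝ) :
    ∫ x, f x ∂μ.withDensity (fun x => ENNReal.ofReal (h x)) = ∫ x, h x * f x ∂μ := by
  rw [integral_withDensity_eq_integral_toReal_smul hh.measurable.ennreal_ofReal (by simp)]
  simp [ENNReal.toReal_ofReal (h0 _)]

theorem isProbabilityMeasure_withDensity_ofReal {X : Type*} [TopologicalSpace X] [CompactSpace X]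
    [MeasurableSpace X] [OpensMeasurableSpace X] (μ : Measure X) [IsFiniteMeasure μ] {h : X → ℝ}
    (hh : Continuous h) (h0 : ∀ x, 0 ≤ h x) (h1 : ∫ x, h x ∂μ = 1) :
    IsProbabilityMeasure (μ.withDensity fun x => ENNReal.ofReal (h x)) := by
  constructor
  rw [withDensity_apply _ MeasurableSet.univ, Measure.restrict_univ,
    ← ofReal_integral_eq_lintegral_ofReal (integrable_of_continuous μ hh) (.of_forall h0), h1,
    ENNReal.ofReal_one]

variable {M : Type*} [MetricSpace M] [CompactSpace M] [MeasurableSpace M] [BorelSpace M]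

/-- Lipschitz tests detect weak convergence, so the constant sequence `μ` converges to `μ'`; weak
limits are unique. -/
theorem ext_of_forall_integral_isLipschitz {μ μ' : Measure (OneSided M)}
    [hμ : IsProbabilityMeasure μ] [hμ' : IsProbabilityMeasure μ']
    (h : ∀ f : OneSided M → ℝ, IsLipschitz f → ∫ x, f x ∂μ = ∫ x, f x ∂μ') : μ = μ' := by
  let _ := seqMetricSpace M
  let P : ProbabilityMeasure (OneSided M) := ⟨μ, hμ⟩
  let P' : ProbabilityMeasure (OneSided M) := ⟨μ', hμ'⟩
  have key : Filter.Tendsto (fun _ : ℕ => P) Filter.atTop (nhds P') := by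
    rw [tendsto_iff_forall_lipschitz_integral_tendsto]
    rintro f - ⟨L, hL⟩
    have : ∫ x, f x ∂μ = ∫ x, f x ∂μ' := by
      refine h f ⟨L, fun x x' => ?_⟩
      exact hL.dist_le_mul x x'
    simp [P, P', this]
  exact (congrArg ProbabilityMeasure.toMeasure (tendsto_nhds_unique key tendsto_const_nhds)).symm

end Integration

/-! ### Positivity and iteration of the Ruelle operator. -/

section RuelleOperator

theorem IsDualEigenvector.integral_eq {M : Type*} [MetricSpace M] [MeasurableSpace M]
    {ν : Measure M} {A f : OneSided M → ℝ} {lam : ℝ} {ρ : Measure (OneSided M)}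
    (h : IsDualEigenvector ν A lam ρ) (hf : Continuous f) :
    ∫ x, ruelle ν A f x ∂ρ = lam * ∫ x, f x ∂ρ :=
  h ⟨f, hf⟩

variable {M : Type*} [MetricSpace M] [CompactSpace M] [MeasurableSpace M] [BorelSpace M]
  {ν : Measure M} [IsProbabilityMeasure ν] {A f : OneSided M → ℝ}

theorem integrable_ruelle (hA : Continuous A) (hf : Continuous f) (x : OneSided M) :
    Integrable (fun a => Real.exp (A (cons a x)) * f (cons a x)) ν :=
  integrable_of_continuous ν
    ((hA.comp (continuous_cons_left x)).rexp.mul (hf.comp (continuous_cons_left x)))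

theorem continuous_ruelle (hA : Continuous A) (hf : Continuous f) :
    Continuous (ruelle ν A f) := by
  have hc : Continuous fun p : OneSided M × M => cons p.2 p.1 :=
    continuous_cons.comp continuous_swap
  exact continuous_integral ν ((hA.comp hc).rexp.mul (hf.comp hc))

theorem ruelle_pos (hA : Continuous A) (hf : Continuous f) (h : ∀ x, 0 < f x) (x : OneSided M) :
    0 < ruelle ν A f x :=
  (integral_pos_iff_support_of_nonneg (fun _ => (mul_pos (Real.exp_pos _) (h _)).le)
    (integrable_ruelle hA hf x)).2 <| by
      have : (Function.support fun a => Real.exp (A (cons a x)) * f (cons a x)) = Set.univ :=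
        Set.eq_univ_of_forall fun a => (mul_pos (Real.exp_pos _) (h _)).ne'
      simp [this]

theorem continuous_iterate_ruelle (hA : Continuous A) (hf : Continuous f) (n : ℕ) :
    Continuous ((ruelle ν A)^[n] f) := by
  induction n with
  | zero => exact hf
  | succ n ih =>
    rw [Function.iterate_succ_apply']
    exact continuous_ruelle hA ih

theorem IsDualEigenvector.integral_iterate {lam : ℝ} {ρ : Measure (OneSided M)}
    (h : IsDualEigenvector ν A lam ρ) (hA : Continuous A) (hf : Continuous f) (n : ℕ) :
    ∫ x, (ruelle ν A)^[n] f x ∂ρ = lam ^ n * ∫ x, f x ∂ρ := by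
  induction n with
  | zero => simp
  | succ n ih =>
    simp only [Function.iterate_succ_apply']
    rw [h.integral_eq (continuous_iterate_ruelle hA hf n), ih, pow_succ']
    ring

theorem integral_pos_of_continuous {X : Type*} [TopologicalSpace X] [CompactSpace X]
    [MeasurableSpace X] [OpensMeasurableSpace X] (μ : Measure X) [IsProbabilityMeasure μ]
    {g : X → ℝ} (hg : Continuous g) (h : ∀ x, 0 < g x) : 0 < ∫ x, g x ∂μ :=
  (integral_pos_iff_support_of_nonneg (fun x => (h x).le) (integrable_of_continuous μ hg)).2 <| by
    have : Function.support g = Set.univ := Set.eq_univ_of_forall fun x => (h x).ne'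
    simp [this]

theorem IsDualEigenvector.pos {lam : ℝ} {ρ : Measure (OneSided M)} [IsProbabilityMeasure ρ]
    (h : IsDualEigenvector ν A lam ρ) (hA : Continuous A) : 0 < lam := by
  have h1 := h.integral_eq (continuous_const (y := (1 : ℝ)))
  rw [integral_const, probReal_univ, one_smul, mul_one] at h1
  rw [← h1]
  exact integral_pos_of_continuous ρ (continuous_ruelle hA continuous_const)
    (ruelle_pos hA continuous_const fun _ => one_pos)

end RuelleOperator

/-! ### Log-Lipschitz cones and uniqueness of dual eigenprobabilities. -/

section Cone

/-- Positive functions whose logarithm is Lipschitz with constant `b`. -/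
def LogLipschitz {M : Type*} [MetricSpace M] (b : ℝ) (f : OneSided M → ℝ) : Prop :=
  (∀ x, 0 < f x) ∧ ∀ x x', f x' ≤ Real.exp (b * seqDist x x') * f x

variable {M : Type*} [MetricSpace M] {b b' : ℝ} {f : OneSided M → ℝ}

theorem LogLipschitz.mono (h : LogLipschitz b f) (hb : b ≤ b') : LogLipschitz b' f := by
  refine ⟨h.1, fun x x' => (h.2 x x').trans ?_⟩
  have := h.1 x
  have := seqDist_nonneg x x'
  gcongr

theorem LogLipschitz.isLipschitz_log (h : LogLipschitz b f) :
    IsLipschitz fun x => Real.log (f x) := by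
  refine isLipschitz_of_le b fun x x' => ?_
  have := Real.log_le_log (h.1 x') (h.2 x x')
  rw [Real.log_mul (Real.exp_pos _).ne' (h.1 x).ne', Real.log_exp] at this
  linarith

theorem IsLipschitz.logLipschitz_add (hf : IsLipschitz f) {m : ℝ} (hm : ∀ x, 1 ≤ f x + m) :
    ∃ b, LogLipschitz b fun x => f x + m := by
  obtain ⟨C, hC0, hC⟩ := hf.exists_nonneg
  refine ⟨C, fun x => by linarith [hm x], fun x x' => ?_⟩
  have h1 := Real.add_one_le_exp (C * seqDist x x')
  have h2 := hC x x'
  have h3 := hm x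
  have h4 : 0 ≤ C * seqDist x x' := mul_nonneg hC0 (seqDist_nonneg _ _)
  calc f x' + m ≤ (C * seqDist x x' + 1) * (f x + m) := by nlinarith
    _ ≤ _ := by gcongr

/-- If `f` varies by a factor at most `K - 1`, then subtracting the constant `c` from `K f` keeps
the function log-Lipschitz. -/
theorem LogLipschitz.mul_sub (h : LogLipschitz b f) (hb : 0 ≤ b) {K c : ℝ} (hK : 1 ≤ K)
    (hc : ∀ x, c ≤ (K - 1) * f x) : LogLipschitz (K * b) fun x => K * f x - c := by
  have hu : ∀ x, f x ≤ K * f x - c := fun x => by linarith [hc x]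
  refine ⟨fun x => (h.1 x).trans_le (hu x), fun x x' => ?_⟩
  have hs : 0 ≤ b * seqDist x x' := mul_nonneg hb (seqDist_nonneg _ _)
  set s := Real.exp (b * seqDist x x') with hsdef
  have hs1 : 1 ≤ s := Real.one_le_exp hs
  have h1 := h.2 x x'
  -- Bernoulli's inequality `1 + K * (s - 1) ≤ s ^ K` is what turns the exponent `b` into `K * b`.
  have h2 := one_add_mul_self_le_rpow_one_add (s := s - 1) (by linarith) hK
  rw [add_sub_cancel, hsdef, ← Real.exp_mul, ← hsdef] at h2
  have h3 : (s - 1) * f x ≤ (s - 1) * (K * f x - c) :=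
    mul_le_mul_of_nonneg_left (hu x) (by linarith)
  have h4 : K * ((s - 1) * f x) ≤ K * ((s - 1) * (K * f x - c)) := by gcongr
  have h5 : K * f x' ≤ K * (s * f x) := by gcongr
  have h6 : 0 ≤ K * f x - c := (h.1 x).le.trans (hu x)
  calc K * f x' - c ≤ (1 + K * (s - 1)) * (K * f x - c) := by linarith
    _ ≤ Real.exp (b * seqDist x x' * K) * (K * f x - c) := by gcongr
    _ = _ := by ring_nf

variable [CompactSpace M]

theorem LogLipschitz.continuous (h : LogLipschitz b f) : Continuous f := by
  have := h.isLipschitz_log.continuous.rexp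
  simpa only [Real.exp_log (h.1 _)] using this

variable [MeasurableSpace M] [BorelSpace M] {ν : Measure M} [IsProbabilityMeasure ν]
  {A : OneSided M → ℝ} {C : ℝ}

/-- Prepending a common letter halves distances, which halves the constants of both `f` and `A`. -/
theorem LogLipschitz.ruelle (hA : Continuous A)
    (hC : ∀ x x', A x' - A x ≤ C * seqDist x x') (h : LogLipschitz b f) :
    LogLipschitz ((b + C) / 2) (ruelle ν A f) := by
  refine ⟨ruelle_pos hA h.continuous h.1, fun x x' => ?_⟩
  rw [Symbolic.ruelle, Symbolic.ruelle, ← integral_const_mul]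
  refine integral_mono (integrable_ruelle hA h.continuous x')
    ((integrable_ruelle hA h.continuous x).const_mul _) fun a => ?_
  have h1 := hC (cons a x) (cons a x')
  have h2 := h.2 (cons a x) (cons a x')
  rw [seqDist_cons] at h1 h2
  have := (h.1 (cons a x)).le
  have := (h.1 (cons a x')).le
  calc Real.exp (A (cons a x')) * f (cons a x')
      ≤ Real.exp (A (cons a x) + C * (seqDist x x' / 2)) *
          (Real.exp (b * (seqDist x x' / 2)) * f (cons a x)) := by
        gcongr
        linarith
    _ = _ := by
        rw [← mul_assoc, ← mul_assoc, ← Real.exp_add, ← Real.exp_add]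
        ring_nf

theorem LogLipschitz.iterate_ruelle (hA : Continuous A)
    (hC : ∀ x x', A x' - A x ≤ C * seqDist x x') (hC0 : 0 ≤ C) (h : LogLipschitz b f) (n : ℕ) :
    LogLipschitz (b / 2 ^ n + C) ((Symbolic.ruelle ν A)^[n] f) := by
  induction n with
  | zero => exact h.mono (by simpa)
  | succ n ih =>
    rw [Function.iterate_succ_apply']
    convert ih.ruelle (ν := ν) hA hC using 1
    rw [pow_succ]
    field_simp
    ring

/-- One contraction step: the defect `1 - t` shrinks by the factor `1 - 1 / K`. It matters that `K`
depends on neither `t`, `b` nor `f`, so the step can be iterated. -/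
theorem dual_eigenvector_gap (hA : IsLipschitz A) {lam : ℝ} {ρ ρ' : Measure (OneSided M)}
    [IsProbabilityMeasure ρ] [IsProbabilityMeasure ρ']
    (hρ : IsDualEigenvector ν A lam ρ) (hρ' : IsDualEigenvector ν A lam ρ') :
    ∃ K : ℝ, 1 < K ∧ ∀ t ≤ 1,
      (∀ b f, LogLipschitz b f → t * ∫ x, f x ∂ρ' ≤ ∫ x, f x ∂ρ) →
      ∀ b f, LogLipschitz b f → (1 - (1 - t) * (1 - 1 / K)) * ∫ x, f x ∂ρ' ≤ ∫ x, f x ∂ρ := by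
  obtain ⟨C, hC0, hC⟩ := hA.exists_nonneg
  have hAc := hA.continuous
  have hlam := hρ.pos hAc
  set D := Metric.diam (Set.univ : Set M)
  refine ⟨Real.exp ((C + 1) * D) + 1, by linarith [Real.exp_pos ((C + 1) * D)],
    fun t ht ih b f hf => ?_⟩
  set K := Real.exp ((C + 1) * D) + 1 with hKdef
  have hK : 1 < K := by linarith [Real.exp_pos ((C + 1) * D)]
  -- Only the number of iterations depends on `b`; afterwards the constant is at most `C + 1`, so
  -- values of `g` have ratio at most `exp ((C + 1) * D) = K - 1`.
  obtain ⟨n, hn⟩ : ∃ n : ℕ, b / 2 ^ n ≤ 1 := by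
    obtain ⟨n, hn⟩ := pow_unbounded_of_one_lt b (one_lt_two)
    exact ⟨n, (div_le_one (by positivity)).2 hn.le⟩
  set g := (ruelle ν A)^[n] f with hgdef
  have hg : LogLipschitz (C + 1) g :=
    (hf.iterate_ruelle hAc hC hC0 n).mono (by linarith)
  have hosc : ∀ x x', g x' ≤ (K - 1) * g x := fun x x' => by
    refine (hg.2 x x').trans ?_
    rw [hKdef, add_sub_cancel_right]
    have := hg.1 x
    gcongr
    exact seqDist_le_diam x x'
  have hgc := hg.continuous
  have hbound : ∀ x', (1 - t) * g x' ≤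
      K * lam ^ n * (∫ x, f x ∂ρ - t * ∫ x, f x ∂ρ') := fun x' => by
    -- Testing on `K * g - g x'` removes the same number `g x'` from both integrals; since the `ρ'`
    -- side carries the factor `t`, a surplus `(1 - t) * g x'` remains. It is then integrated over
    -- `x'` against `ρ'`.
    have h1 := ih _ _ (hg.mul_sub (by linarith) hK.le fun x => hosc x x')
    have hint : ∀ (m : Measure (OneSided M)) [IsProbabilityMeasure m],
        IsDualEigenvector ν A lam m →
        ∫ x, (K * g x - g x') ∂m = K * (lam ^ n * ∫ x, f x ∂m) - g x' := fun m _ hm => by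
      rw [integral_sub ((integrable_of_continuous m hgc).const_mul K) (integrable_const _),
        integral_const_mul, hm.integral_iterate hAc hf.continuous]
      simp
    rw [hint ρ hρ, hint ρ' hρ'] at h1
    linarith
  have h2 := integral_mono ((integrable_of_continuous ρ' hgc).const_mul (1 - t))
    (integrable_const _) hbound
  rw [integral_const_mul, hρ'.integral_iterate hAc hf.continuous, integral_const,
    probReal_univ, one_smul] at h2
  have h3 : (1 - t) * ∫ x, f x ∂ρ' ≤ K * (∫ x, f x ∂ρ - t * ∫ x, f x ∂ρ') := by
    refine le_of_mul_le_mul_left ?_ (pow_pos hlam n)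
    linarith
  rw [← div_le_iff₀' (by linarith)] at h3
  have h4 (I : ℝ) : (1 - (1 - t) * (1 - 1 / K)) * I = t * I + (1 - t) * I / K := by ring
  rw [h4]
  linarith

/-- The comparison holds trivially at `t = 0` by positivity; iterating the contraction drives `t` to
`1`. -/
theorem dual_eigenvector_le (hA : IsLipschitz A) {lam : ℝ} {ρ ρ' : Measure (OneSided M)}
    [IsProbabilityMeasure ρ] [IsProbabilityMeasure ρ']
    (hρ : IsDualEigenvector ν A lam ρ) (hρ' : IsDualEigenvector ν A lam ρ')
    (hf : LogLipschitz b f) : ∫ x, f x ∂ρ' ≤ ∫ x, f x ∂ρ := by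
  obtain ⟨K, hK, h⟩ := dual_eigenvector_gap hA hρ hρ'
  have hK0 : 0 ≤ 1 - 1 / K := by
    rw [sub_nonneg, div_le_one (by linarith)]
    exact hK.le
  have hK1 : 1 - 1 / K < 1 := by
    have : 0 < 1 / K := by positivity
    linarith
  have key : ∀ n : ℕ, ∀ b f, LogLipschitz b f →
      (1 - (1 - 1 / K) ^ n) * ∫ x, f x ∂ρ' ≤ ∫ x, f x ∂ρ := by
    intro n
    induction n with
    | zero =>
      intro b f hf
      simpa using integral_nonneg fun x => (hf.1 x).le
    | succ n ih =>
      have := h _ (by linarith [pow_nonneg hK0 n]) ih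
      simpa only [sub_sub_cancel, ← pow_succ] using this
  have hlim := ((tendsto_pow_atTop_nhds_zero_of_lt_one hK0 hK1).const_sub 1).mul_const
    (∫ x, f x ∂ρ')
  rw [sub_zero, one_mul] at hlim
  exact le_of_tendsto' hlim fun n => key n b f hf

theorem dual_eigenvector_unique (hA : IsLipschitz A) {lam : ℝ} {ρ ρ' : Measure (OneSided M)}
    [IsProbabilityMeasure ρ] [IsProbabilityMeasure ρ']
    (hρ : IsDualEigenvector ν A lam ρ) (hρ' : IsDualEigenvector ν A lam ρ') : ρ = ρ' := by
  refine ext_of_forall_integral_isLipschitz fun f hf => ?_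
  obtain ⟨m, hm⟩ := (isCompact_range hf.continuous).bddBelow
  -- Adding a constant makes `f` at least `1`, hence log-Lipschitz; it cancels because both measures
  -- have mass one.
  obtain ⟨b, hb⟩ := hf.logLipschitz_add (m := 1 - m)
    fun x => by linarith [hm (Set.mem_range_self x)]
  have h1 := dual_eigenvector_le hA hρ hρ' hb
  have h2 := dual_eigenvector_le hA hρ' hρ hb
  rw [integral_add (integrable_of_continuous _ hf.continuous) (integrable_const _),
    integral_add (integrable_of_continuous _ hf.continuous) (integrable_const _)] at h1 h2
  simp only [integral_const, probReal_univ, one_smul] at h1 h2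
  linarith

end Cone

/-! ### Existence and uniqueness of the equilibrium probability. -/

section Equilibrium

/-- Backward orbits are dense: `pre n z` has the first `n` letters of `z` followed by a fixed point
of `Z`, and tends to `z`. -/
theorem eq_univ_of_isClosed_of_cons_mem {M : Type*} [MetricSpace M] {Z : Set (OneSided M)} (hZ : IsClosed Z)
    (hne : Z.Nonempty) (hcons : ∀ a, ∀ x ∈ Z, cons a x ∈ Z) : Z = Set.univ := by
  obtain ⟨x, hx⟩ := hne
  let pre : ℕ → OneSided M → OneSided M :=
    fun n => Nat.rec (fun _ => x) (fun _ p z => cons (z 0) (p (shift z))) n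
  have hpre : ∀ n z, pre n z ∈ Z := by
    intro n
    induction n with
    | zero => exact fun _ => hx
    | succ n ih => exact fun z => hcons _ _ (ih _)
  have hval : ∀ n i z, i < n → pre n z i = z i := by
    intro n
    induction n with
    | zero => exact fun i _ h => absurd h (Nat.not_lt_zero i)
    | succ n ih =>
      intro i z h
      cases i with
      | zero => rfl
      | succ i => exact ih i (shift z) (by omega)
  refine Set.eq_univ_of_forall fun z => hZ.mem_of_tendsto (b := Filter.atTop)
    (f := fun n => pre n z) (tendsto_pi_nhds.2 fun i => ?_) (.of_forall fun n => hpre n z)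
  refine tendsto_const_nhds.congr' ?_
  filter_upwards [Filter.eventually_gt_atTop i] with n hn
  exact (hval n i z hn).symm

variable {M : Type*} [MetricSpace M] {A : OneSided M → ℝ} {lam : ℝ} {h : C(OneSided M, ℝ)}

theorem normalizedPotential_eq_of_eq_mul {h' : C(OneSided M, ℝ)} {t : ℝ} (ht : 0 < t)
    (hpos : ∀ x, 0 < h x) (hh' : ∀ x, h' x = t * h x) :
    normalizedPotential A lam h' = normalizedPotential A lam h := by
  funext x
  simp only [normalizedPotential, hh', Real.log_mul ht.ne' (hpos _).ne']
  ring

theorem isLipschitz_normalizedPotential [CompactSpace M] (hA : IsLipschitz A) {b : ℝ}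
    (hh : LogLipschitz b h) :
    IsLipschitz (normalizedPotential A lam h) := by
  obtain ⟨C, -, hC⟩ := hA.exists_nonneg
  obtain ⟨B, hB0, hB⟩ := hh.isLipschitz_log.exists_nonneg
  refine isLipschitz_of_le (C + B + B * 2) fun x x' => ?_
  have h1 := hC x x'
  have h2 := hB x x'
  have h3 := hB (shift x') (shift x)
  rw [seqDist_comm] at h3
  have h4 := mul_le_mul_of_nonneg_left (seqDist_shift_le x x') hB0
  simp only [normalizedPotential]
  linarith

variable [MeasurableSpace M] {ν : Measure M}

theorem IsMainEigenpair.ruelle_normalizedPotential (hh : IsMainEigenpair ν A lam h)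
    (f : OneSided M → ℝ) (x : OneSided M) :
    ruelle ν (normalizedPotential A lam h) f x =
      (lam * h x)⁻¹ * ruelle ν A (fun z => h z * f z) x := by
  rw [ruelle, ruelle, ← integral_const_mul]
  congr 1
  funext a
  simp only [normalizedPotential, shift_cons]
  rw [Real.exp_sub, Real.exp_sub, Real.exp_add, Real.exp_log (hh.2.1 _), Real.exp_log (hh.2.1 _),
    Real.exp_log hh.1]
  have := hh.1.ne'
  have := (hh.2.1 x).ne'
  field_simp

theorem IsMainEigenpair.ruelle_normalizedPotential_comp_shift (hh : IsMainEigenpair ν A lam h)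
    (f : OneSided M → ℝ) (x : OneSided M) :
    ruelle ν (normalizedPotential A lam h) (fun z => f (shift z)) x = f x := by
  rw [hh.ruelle_normalizedPotential]
  have e := hh.2.2 x
  rw [ruelle] at e
  simp only [ruelle, shift_cons, ← mul_assoc]
  rw [integral_mul_const, e, ← mul_assoc, inv_mul_cancel₀ (mul_pos hh.1 (hh.2.1 x)).ne', one_mul]

variable [CompactSpace M] [BorelSpace M]

theorem IsMainEigenpair.eigenvalue_eq {lam' : ℝ} (hh : IsMainEigenpair ν A lam' h)
    {ρ : Measure (OneSided M)} [IsProbabilityMeasure ρ] (hρ : IsDualEigenvector ν A lam ρ) :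
    lam' = lam := by
  have h1 := hρ h
  simp only [hh.2.2] at h1
  rw [integral_const_mul] at h1
  exact mul_right_cancel₀ (integral_pos_of_continuous ρ h.continuous hh.2.1).ne' h1

/-- If `L_A h = lam h`, `L_A^* ρ = lam ρ` and `∫ h dρ = 1`, then `h dρ` is an equilibrium
probability. -/
theorem IsMainEigenpair.isEquilibriumProbability (hh : IsMainEigenpair ν A lam h)
    {ρ : Measure (OneSided M)} [IsProbabilityMeasure ρ]
    (hρ : IsDualEigenvector ν A lam ρ) (h1 : ∫ x, h x ∂ρ = 1) :
    IsEquilibriumProbability ν A (ρ.withDensity fun x => ENNReal.ofReal (h x)) := by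
  have hpos := fun x => (hh.2.1 x).le
  have hprob := isProbabilityMeasure_withDensity_ofReal ρ h.continuous hpos h1
  have hdual : IsDualEigenvector ν (normalizedPotential A lam h) 1
      (ρ.withDensity fun x => ENNReal.ofReal (h x)) := fun f => by
    rw [integral_withDensity_ofReal ρ h.continuous hpos,
      integral_withDensity_ofReal ρ h.continuous hpos, one_mul]
    have e : ∀ x, h x * ruelle ν (normalizedPotential A lam h) f x =
        lam⁻¹ * ruelle ν A (fun z => h z * f z) x := fun x => by
      have := (hh.2.1 x).ne'
      rw [hh.ruelle_normalizedPotential, mul_inv]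
      field_simp
    simp only [e]
    have e' := hρ.integral_eq (f := fun z => h z * f z) (h.continuous.mul f.continuous)
    rw [integral_const_mul, e', ← mul_assoc,
      inv_mul_cancel₀ hh.1.ne', one_mul]
  refine ⟨hprob, ⟨continuous_shift.measurable, ?_⟩, lam, h, hh, hdual⟩
  have := Measure.isProbabilityMeasure_map
    (μ := ρ.withDensity fun x => ENNReal.ofReal (h x))
    (continuous_shift (M := M)).measurable.aemeasurable
  refine ext_of_forall_integral_continuous fun f hf => ?_
  rw [integral_map continuous_shift.measurable.aemeasurable hf.aestronglyMeasurable]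
  have e := hdual.integral_eq (f := fun x => f (shift x)) (hf.comp continuous_shift)
  rw [one_mul] at e
  rw [← e]
  exact integral_congr_ae (.of_forall fun x => hh.ruelle_normalizedPotential_comp_shift f x)

variable [IsProbabilityMeasure ν]

/-- With `t` the minimum of `h' / h`, the function `h' - t * h` is a nonnegative eigenfunction with
a zero, and its zeros propagate to all preimages under the shift. -/
theorem IsMainEigenpair.eq_mul [ν.IsOpenPosMeasure] (hA : Continuous A)
    {h' : C(OneSided M, ℝ)} (hh : IsMainEigenpair ν A lam h) (hh' : IsMainEigenpair ν A lam h')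
    [Nonempty M] : ∃ t : ℝ, 0 < t ∧ ∀ x, h' x = t * h x := by
  have hcq : Continuous fun x => h' x / h x :=
    h'.continuous.div h.continuous fun x => (hh.2.1 x).ne'
  obtain ⟨x₀, -, hx₀⟩ := isCompact_univ.exists_isMinOn Set.univ_nonempty hcq.continuousOn
  set t := h' x₀ / h x₀ with ht
  have hle : ∀ x, 0 ≤ h' x - t * h x := fun x => by
    have : t ≤ h' x / h x := hx₀ (Set.mem_univ x)
    rw [le_div_iff₀ (hh.2.1 x)] at this
    linarith
  have hw : Continuous fun x => h' x - t * h x :=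
    h'.continuous.sub (continuous_const.mul h.continuous)
  refine ⟨t, div_pos (hh'.2.1 _) (hh.2.1 _), fun x => ?_⟩
  have hZ : {x | h' x - t * h x = 0} = Set.univ := by
    refine eq_univ_of_isClosed_of_cons_mem (isClosed_eq hw continuous_const) ⟨x₀, ?_⟩ fun a x hx => ?_
    · have := (hh.2.1 x₀).ne'
      simp only [Set.mem_ofPred_eq, ht]
      field_simp
      ring
    · have h1 : ∫ a, Real.exp (A (cons a x)) * (h' (cons a x) - t * h (cons a x)) ∂ν = 0 := by
        simp only [mul_sub, mul_left_comm _ t]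
        rw [integral_sub (integrable_ruelle hA h'.continuous x)
          ((integrable_ruelle hA h.continuous x).const_mul t), integral_const_mul]
        have e1 := hh.2.2 x
        have e2 := hh'.2.2 x
        rw [ruelle] at e1 e2
        rw [e1, e2, mul_left_comm, ← mul_sub, show h' x - t * h x = 0 from hx, mul_zero]
      have hc : Continuous fun a =>
          Real.exp (A (cons a x)) * (h' (cons a x) - t * h (cons a x)) :=
        (hA.comp (continuous_cons_left x)).rexp.mul (hw.comp (continuous_cons_left x))
      rw [integral_eq_zero_iff_of_nonneg (fun a => mul_nonneg (Real.exp_pos _).le (hle _))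
        (integrable_of_continuous ν hc)] at h1
      -- Full support of `ν` upgrades almost everywhere vanishing of a continuous function to every
      -- letter `a`.
      have h2 := congrFun (((hc.ae_eq_iff_eq ν) (continuous_const (y := (0 : ℝ)))).1 h1) a
      exact (mul_eq_zero.1 h2).resolve_left (Real.exp_pos _).ne'
  have : x ∈ {x | h' x - t * h x = 0} := hZ ▸ Set.mem_univ x
  linarith [show h' x - t * h x = 0 from this]

theorem IsEquilibriumProbability.unique [ν.IsOpenPosMeasure] (hA : IsLipschitz A)
    (hh : IsMainEigenpair ν A lam h) {b : ℝ} (hlog : LogLipschitz b h)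
    {ρ : Measure (OneSided M)} [IsProbabilityMeasure ρ] (hρ : IsDualEigenvector ν A lam ρ)
    {μ μ' : Measure (OneSided M)} (hμ : IsEquilibriumProbability ν A μ)
    (hμ' : IsEquilibriumProbability ν A μ') : μ = μ' := by
  have : Nonempty M := nonempty_of_isProbabilityMeasure ν
  -- The eigenfunction attached to `m` is only assumed continuous; proportionality to `h` replaces
  -- its normalized potential by the Lipschitz one of `h`.
  have key : ∀ m, IsEquilibriumProbability ν A m →
      IsDualEigenvector ν (normalizedPotential A lam h) 1 m := by
    rintro m ⟨_, -, lam', h', hh', hm⟩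
    obtain rfl := hh'.eigenvalue_eq hρ
    obtain ⟨t, ht, e⟩ := hh.eq_mul hA.continuous hh'
    rwa [← normalizedPotential_eq_of_eq_mul ht hh.2.1 e]
  have := hμ.1
  have := hμ'.1
  exact dual_eigenvector_unique (isLipschitz_normalizedPotential hA hlog) (key μ hμ) (key μ' hμ')

end Equilibrium

/-! ### The two-sided shift and its translated right halves. -/

section TwoSidedShift

/-- The right half of the sequence after moving the origin `n` steps to the left. -/
def rightHalf {M : Type*} (n : ℕ) (p : TwoSided M) : OneSided M := (((twoSidedShift M).symm)^[n] p).2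

theorem shift_rightHalf {M : Type*} (n : ℕ) (p : TwoSided M) :
    shift (rightHalf (n + 1) p) = rightHalf n p := by
  rw [rightHalf, Function.iterate_succ_apply']
  rfl

theorem fst_eq_rightHalf {M : Type*} (p : TwoSided M) (n : ℕ) : p.1 n = rightHalf (n + 1) p 0 := by
  have h : ∀ n, (((twoSidedShift M).symm)^[n] p).1 0 = p.1 n := by
    intro n
    induction n generalizing p with
    | zero => rfl
    | succ n ih => exact ih _
  rw [rightHalf, Function.iterate_succ_apply', ← h n]
  rfl

variable {M : Type*} [MetricSpace M]

theorem continuous_twoSidedShift : Continuous (twoSidedShift M) := by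
  have h1 : Continuous fun p : TwoSided M => (p.2 0, p.1) :=
    ((continuous_apply 0).comp continuous_snd).prodMk continuous_fst
  have h2 : Continuous fun p : TwoSided M => cons (p.2 0) p.1 := continuous_cons.comp h1
  have h3 : Continuous fun p : TwoSided M => shift p.2 := continuous_shift.comp continuous_snd
  exact h2.prodMk h3

theorem continuous_twoSidedShift_symm : Continuous (twoSidedShift M).symm := by
  have h1 : Continuous fun p : TwoSided M => (p.1 0, p.2) :=
    ((continuous_apply 0).comp continuous_fst).prodMk continuous_snd
  have h2 : Continuous fun p : TwoSided M => cons (p.1 0) p.2 := continuous_cons.comp h1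
  have h3 : Continuous fun p : TwoSided M => shift p.1 := continuous_shift.comp continuous_fst
  exact h3.prodMk h2

end TwoSidedShift

/-! ### The involution kernel, its eigenfunction and the kernel measure. -/

section Kernel

variable {M : Type*} [MetricSpace M] {A A' : OneSided M → ℝ} {W : TwoSided M → ℝ}

theorem IsInvolutionKernel.exp_mul_exp (hW : IsInvolutionKernel A W A') (c : ℝ) (a : M)
    (y x : OneSided M) :
    Real.exp (A (cons a x)) * Real.exp (W (y, cons a x) - c) =
      Real.exp (A' (cons a y)) * Real.exp (W (cons a y, x) - c) := by
  have := hW.2 (cons a y, x)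
  simp only [twoSidedShift, Equiv.symm, Equiv.coe_fn_mk, shift_cons] at this
  rw [← Real.exp_add, ← Real.exp_add, this]
  congr 1
  simp only [cons]
  ring

theorem continuous_expKernel (hWc : Continuous W) (c : ℝ) :
    Continuous fun p : OneSided M × OneSided M => Real.exp (W (p.2, p.1) - c) :=
  ((hWc.comp continuous_swap).sub continuous_const).rexp

variable [CompactSpace M]

theorem IsInvolutionKernel.continuous_dual [Nonempty M] (hA : Continuous A)
    (hW : IsInvolutionKernel A W A') : Continuous A' := by
  have hWc := hW.1.continuous
  let x₀ : OneSided M := fun _ => Classical.arbitrary M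
  have e : A' = fun y => A (cons (y 0) x₀) + W (shift y, cons (y 0) x₀) - W (y, x₀) :=
    funext fun y => hW.2 (y, x₀)
  rw [e]
  have h1 : Continuous fun y : OneSided M => cons (y 0) x₀ :=
    (continuous_cons_left x₀).comp (continuous_apply 0)
  exact ((hA.comp h1).add (hWc.comp (continuous_shift.prodMk h1))).sub
    (hWc.comp (continuous_id.prodMk continuous_const))

variable [MeasurableSpace M] [BorelSpace M]

/-- The eigenfunction `x ↦ ∫ e^{W(y|x) - c} dρ'(y)`. -/
noncomputable def kernelEigenfunction (hWc : Continuous W) (c : ℝ) (ρ' : Measure (OneSided M))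
    [IsFiniteMeasure ρ'] : C(OneSided M, ℝ) where
  toFun x := ∫ y, Real.exp (W (y, x) - c) ∂ρ'
  continuous_toFun := continuous_integral ρ' (continuous_expKernel hWc c)

theorem logLipschitz_kernelEigenfunction (hW : IsLipschitzTwoSided W) (c : ℝ)
    (ρ' : Measure (OneSided M)) [IsProbabilityMeasure ρ'] :
    ∃ b, LogLipschitz b (kernelEigenfunction hW.continuous c ρ') := by
  obtain ⟨C, hC⟩ := id hW
  have hc : ∀ x, Continuous fun y => Real.exp (W (y, x) - c) := fun x =>
    (continuous_expKernel hW.continuous c).comp (continuous_const.prodMk continuous_id)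
  refine ⟨C, fun x => integral_pos_of_continuous ρ' (hc x) fun y => Real.exp_pos _,
    fun x x' => ?_⟩
  simp only [kernelEigenfunction, ContinuousMap.coe_mk]
  rw [← integral_const_mul]
  refine integral_mono (integrable_of_continuous _ (hc x'))
    ((integrable_of_continuous _ (hc x)).const_mul _) fun y => ?_
  have h1 := (abs_le.1 (hC (y, x) (y, x'))).1
  simp only [seqDist_self, zero_add] at h1
  simp only
  rw [← Real.exp_add]
  gcongr
  linarith

variable {ν : Measure M} [IsProbabilityMeasure ν] {lam' : ℝ} {ρ' : Measure (OneSided M)}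
  [IsProbabilityMeasure ρ']

/-- The dual eigenvector equation for `ρ'` is applied with `x` frozen; the kernel identity and
Fubini then move the averaged letter `a` from the left half to the right. -/
theorem ruelle_integral_kernel (hA : Continuous A) (hW : IsInvolutionKernel A W A')
    (hρ' : IsDualEigenvector ν A' lam' ρ') (c : ℝ) {F : TwoSided M → ℝ} (hF : Continuous F)
    (x : OneSided M) :
    ∫ a, Real.exp (A (cons a x)) * ∫ y, Real.exp (W (y, cons a x) - c) * F (cons a y, x) ∂ρ' ∂ν =
      lam' * ∫ y, Real.exp (W (y, x) - c) * F (y, x) ∂ρ' := by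
  have : Nonempty M := nonempty_of_isProbabilityMeasure ν
  have hWc := hW.1.continuous
  have hA' := hW.continuous_dual hA
  have hf : Continuous fun y => Real.exp (W (y, x) - c) * F (y, x) :=
    ((continuous_expKernel hWc c).comp (continuous_const.prodMk continuous_id)).mul
      (hF.comp (continuous_id.prodMk continuous_const))
  rw [← hρ'.integral_eq hf]
  simp only [ruelle, ← integral_const_mul, ← mul_assoc, ← hW.exp_mul_exp]
  simp only [hW.exp_mul_exp]
  refine integral_swap_of_continuous ν ρ' ?_
  simp only [mul_assoc]
  have h1 : Continuous fun p : M × OneSided M => cons p.1 p.2 := continuous_cons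
  exact (hA'.comp h1).rexp.mul (hf.comp h1)

theorem kernelEigenfunction_isMainEigenpair (hA : Continuous A) (hW : IsInvolutionKernel A W A')
    (hρ' : IsDualEigenvector ν A' lam' ρ') (c : ℝ) :
    IsMainEigenpair ν A lam' (kernelEigenfunction hW.1.continuous c ρ') := by
  have : Nonempty M := nonempty_of_isProbabilityMeasure ν
  obtain ⟨b, hb⟩ := logLipschitz_kernelEigenfunction hW.1 c ρ'
  refine ⟨hρ'.pos (hW.continuous_dual hA), hb.1, fun x => ?_⟩
  simpa [ruelle, kernelEigenfunction] using
    ruelle_integral_kernel hA hW hρ' c (F := fun _ => 1) continuous_const x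

variable {ρ : Measure (OneSided M)} [IsProbabilityMeasure ρ] {lam : ℝ}

theorem integral_kernelMeasure (hWc : Continuous W) (c : ℝ) {F : TwoSided M → ℝ}
    (hF : Continuous F) :
    ∫ p, F p ∂kernelMeasure W c ρ' ρ = ∫ x, ∫ y, Real.exp (W (y, x) - c) * F (y, x) ∂ρ' ∂ρ := by
  have hc : Continuous fun p : TwoSided M => Real.exp (W p - c) :=
    (hWc.sub continuous_const).rexp
  rw [kernelMeasure, integral_withDensity_ofReal _ hc (fun _ => (Real.exp_pos _).le)]
  exact integral_prod_symm _ (integrable_of_continuous _ (hc.mul hF))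

theorem isProbabilityMeasure_kernelMeasure (hWc : Continuous W) {c : ℝ}
    (hc : ∫ x, ∫ y, Real.exp (W (y, x) - c) ∂ρ' ∂ρ = 1) :
    IsProbabilityMeasure (kernelMeasure W c ρ' ρ) := by
  have hec : Continuous fun p : TwoSided M => Real.exp (W p - c) :=
    (hWc.sub continuous_const).rexp
  refine isProbabilityMeasure_withDensity_ofReal _ hec (fun _ => (Real.exp_pos _).le) ?_
  rw [← hc]
  exact integral_prod_symm _ (integrable_of_continuous _ hec)

theorem map_snd_kernelMeasure (hWc : Continuous W) {c : ℝ}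
    (hc : ∫ x, ∫ y, Real.exp (W (y, x) - c) ∂ρ' ∂ρ = 1) :
    (kernelMeasure W c ρ' ρ).map Prod.snd =
      ρ.withDensity fun x => ENNReal.ofReal (kernelEigenfunction hWc c ρ' x) := by
  have := isProbabilityMeasure_kernelMeasure hWc hc
  have hpos : ∀ x, 0 ≤ kernelEigenfunction hWc c ρ' x := fun x =>
    integral_nonneg fun y => (Real.exp_pos _).le
  have := isProbabilityMeasure_withDensity_ofReal ρ
    (kernelEigenfunction hWc c ρ').continuous hpos hc
  have := Measure.isProbabilityMeasure_map (μ := kernelMeasure W c ρ' ρ)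
    measurable_snd.aemeasurable
  refine ext_of_forall_integral_continuous fun f hf => ?_
  rw [integral_map measurable_snd.aemeasurable hf.aestronglyMeasurable,
    integral_withDensity_ofReal ρ (kernelEigenfunction hWc c ρ').continuous hpos,
    integral_kernelMeasure hWc c (F := fun p => f p.2) (hf.comp continuous_snd)]
  simp only [integral_mul_const]
  rfl

theorem measurePreserving_kernelMeasure (hA : Continuous A) (hW : IsInvolutionKernel A W A')
    (hρ : IsDualEigenvector ν A lam ρ) (hρ' : IsDualEigenvector ν A' lam ρ') {c : ℝ}
    (hc : ∫ x, ∫ y, Real.exp (W (y, x) - c) ∂ρ' ∂ρ = 1) :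
    MeasurePreserving (twoSidedShift M) (kernelMeasure W c ρ' ρ) (kernelMeasure W c ρ' ρ) := by
  have hWc := hW.1.continuous
  have hs := continuous_twoSidedShift (M := M)
  have := isProbabilityMeasure_kernelMeasure hWc hc
  have := Measure.isProbabilityMeasure_map (μ := kernelMeasure W c ρ' ρ)
    hs.measurable.aemeasurable
  refine ⟨hs.measurable, ext_of_forall_integral_continuous fun F hF => ?_⟩
  rw [integral_map hs.measurable.aemeasurable hF.aestronglyMeasurable,
    integral_kernelMeasure hWc c (F := fun p => F (twoSidedShift M p)) (hF.comp hs),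
    integral_kernelMeasure hWc c hF]
  have hG : Continuous fun x => ∫ y, Real.exp (W (y, x) - c) *
      F (twoSidedShift M (y, x)) ∂ρ' :=
    continuous_integral ρ' ((continuous_expKernel hWc c).mul
      ((hF.comp hs).comp continuous_swap))
  -- Here the two eigenvalues must coincide: `lam` enters through `ρ` and leaves through `ρ'`.
  refine mul_left_cancel₀ (hρ.pos hA).ne' ?_
  rw [← hρ.integral_eq hG, ← integral_const_mul]
  congr 1
  funext x
  exact ruelle_integral_kernel hA hW hρ' c hF x

end Kernel

/-! ### Uniqueness of the invariant extension. -/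

section Extension

variable {M : Type*} [MetricSpace M] [CompactSpace M] [MeasurableSpace M] [BorelSpace M]

theorem measurable_rightHalf (n : ℕ) : Measurable (rightHalf (M := M) n) :=
  (continuous_snd.comp (continuous_twoSidedShift_symm.iterate n)).measurable

theorem IsInvariantExtension.unique {μ : Measure (OneSided M)} {η η' : Measure (TwoSided M)}
    (hη : IsInvariantExtension μ η) (hη' : IsInvariantExtension μ η') : η = η' := by
  have hmap : ∀ m, IsInvariantExtension μ m → ∀ n, m.map (rightHalf n) = μ := by
    intro m hm n
    let e : TwoSided M ≃ᵐ TwoSided M :=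
      ⟨twoSidedShift M, continuous_twoSidedShift.measurable,
        continuous_twoSidedShift_symm.measurable⟩
    have h1 : MeasurePreserving (twoSidedShift M).symm m m :=
      MeasurePreserving.symm e hm.2.1
    have h2 := h1.iterate n
    rw [← hm.2.2]
    conv_rhs => rw [← h2.map_eq, Measure.map_map measurable_snd h2.measurable]
    rfl
  have := hη.1
  have := hη'.1
  -- Each right half is the shift of the next, so these σ-algebras increase and their union is a
  -- π-system; the left coordinates appear as the heads of the right halves.
  let 𝓜 : ℕ → MeasurableSpace (TwoSided M) := fun n => .comap (rightHalf n) inferInstance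
  have hmono : Monotone 𝓜 := by
    refine monotone_nat_of_le_succ fun n => ?_
    rintro _ ⟨s, hs, rfl⟩
    refine ⟨shift ⁻¹' s, continuous_shift.measurable hs, ?_⟩
    ext p
    simp only [Set.mem_preimage, shift_rightHalf]
  have hgen : (inferInstance : MeasurableSpace (TwoSided M)) = ⨆ n, 𝓜 n := by
    apply le_antisymm
    · have hr : ∀ n, @Measurable _ _ (⨆ n, 𝓜 n) _ (rightHalf (M := M) n) := fun n =>
        (comap_measurable (rightHalf n)).mono (le_iSup 𝓜 n) le_rfl
      have h1 : @Measurable _ _ (⨆ n, 𝓜 n) _ (fun p : TwoSided M => p.1) := by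
        refine @measurable_pi_lambda _ _ _ (⨆ n, 𝓜 n) _ _ fun n => ?_
        simp only [fst_eq_rightHalf]
        exact (measurable_pi_apply 0).comp (hr (n + 1))
      have h2 : @Measurable _ _ (⨆ n, 𝓜 n) _ (fun p : TwoSided M => p.2) := hr 0
      exact sup_le h1.comap_le h2.comap_le
    · exact iSup_le fun n => (measurable_rightHalf n).comap_le
  refine ext_of_generate_finite (⋃ n, {s | MeasurableSet[𝓜 n] s}) ?_
    (isPiSystem_iUnion_of_monotone _ (fun n => @MeasurableSpace.isPiSystem_measurableSet _ (𝓜 n))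
      fun i j hij s hs => hmono hij s hs) ?_ (by simp)
  · exact hgen.trans (MeasurableSpace.generateFrom_iUnion_measurableSet 𝓜).symm
  · intro s hs
    obtain ⟨n, t, ht, rfl⟩ := Set.mem_iUnion.1 hs
    rw [← Measure.map_apply (measurable_rightHalf n) ht,
      ← Measure.map_apply (measurable_rightHalf n) ht, hmap η hη n, hmap η' hη' n]

end Extension

end Symbolic

open Symbolic
theorem proposition6p3 {M : Type*} [MetricSpace M] [CompactSpace M] [MeasurableSpace M]
    [BorelSpace M] (ν : Measure M) [IsProbabilityMeasure ν] [ν.IsOpenPosMeasure]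
    (A : OneSided M → ℝ) (hA : IsLipschitz A)
    (W : TwoSided M → ℝ) (A' : OneSided M → ℝ) (hW : IsInvolutionKernel A W A')
    (ρ ρ' : Measure (OneSided M)) (hρ : IsEigenmeasure ν A ρ) (hρ' : IsEigenmeasure ν A' ρ')
    (c : ℝ) (hc : ∫ x, ∫ y, Real.exp (W (y, x) - c) ∂ρ' ∂ρ = 1) :
    (∃! μ : Measure (OneSided M), IsEquilibriumProbability ν A μ) ∧
      ∀ μ : Measure (OneSided M), IsEquilibriumProbability ν A μ →
        IsInvariantExtension μ (kernelMeasure W c ρ' ρ) ∧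
          ∀ η : Measure (TwoSided M), IsInvariantExtension μ η →
            η = kernelMeasure W c ρ' ρ := by
  obtain ⟨_, lam, hρ⟩ := hρ
  obtain ⟨_, lam', hρ'⟩ := hρ'
  have hpair := kernelEigenfunction_isMainEigenpair hA.continuous hW hρ' c
  obtain ⟨b, hlog⟩ := logLipschitz_kernelEigenfunction hW.1 c ρ'
  obtain rfl := hpair.eigenvalue_eq hρ
  have heq := hpair.isEquilibriumProbability hρ hc
  refine ⟨⟨_, heq, fun μ hμ => hμ.unique hA hpair hlog hρ heq⟩, fun μ hμ => ?_⟩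
  have hext : IsInvariantExtension μ (kernelMeasure W c ρ' ρ) :=
    ⟨isProbabilityMeasure_kernelMeasure hW.1.continuous hc,
      measurePreserving_kernelMeasure hA.continuous hW hρ hρ' hc,
      (map_snd_kernelMeasure hW.1.continuous hc).trans (heq.unique hA hpair hlog hρ hμ)⟩
  exact ⟨hext, fun η hη => hη.unique hext⟩
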